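/- Let $E$ be a real Banach space that is 2-uniformly convex (for some $c>0$ its modulus of convexity satisfies $\delta_E(\varepsilon)\ge c\varepsilon^2$ on $[0,2]$) and uniformly smooth, with normalized duality mapping $J:E\to E^*$, $\langle Jx,x\rangle=\|Jx\|^2=\|x\|^2$. Assume that $J$ is weakly sequentially continuous: $x_n\rightharpoonup x$ implies $Jx_n\rightharpoonup^* Jx$. Let $B:E\to 2^{E^*}$ be maximal monotone, let $A:E\to E^*$ be monotone and Lipschitz continuous, and assume that $(A+B)^{-1}(0)=\{x\in E: 0\in Ax+Bx\}$ is nonempty. Let $\mu$ be the 2-uniform convexity constant of $E$, the least $\mu\ge 1$ such that $$\tfrac12\left(\|x+y\|^2+\|x-y\|^2\right)\ \ge\ \|x\|^2+\mu^{-1}\|y\|^2\qquad\text{for all }x,y\in E,$$ and let $\kappa>0$ be a 2-uniform smoothness constant of $E^*$, that is, $$\|f+g\|^2\le\|f\|^2+2\langle g,J_*f\rangle+2\kappa^2\|g\|^2\qquad\text{for all }f,g\in E^*,$$ where $J_*$ is the normalized duality mapping of $E^*$. Let $\gamma>0$, $l\in(0,1)$, $\theta\in\left(0,\frac{1}{\sqrt{2\mu}\,\kappa}\right)$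 and $x_1\in E$. For $x\in E$ and $\lambda>0$ write $y_\lambda(x)=(J+\lambda B)^{-1}(Jx-\lambda Ax)$. Let $(x_n)$ be generated by the following algorithm (Algorithm 2): for $n\ge1$, let $\lambda_n$ be the largest $\lambda\in\{\gamma,\gamma l,\gamma l^2,\dots\}$ with $$\lambda\,\|Ax_n-Ay_\lambda(x_n)\|\le\theta\,\|x_n-y_\lambda(x_n)\|,$$ put $y_n=y_{\lambda_n}(x_n)$, and set $$x_{n+1}=J^{-1}\left[Jy_n-\lambda_n(Ay_n-Ax_n)\right].$$ (If $y_n=x_n$, the algorithm stops; the recursion then gives $x_m=x_n$ for all $m\ge n$, and the sequence is understood to be continued in this way.) Then $(x_n)$ converges weakly to a point $z\in(A+B)^{-1}(0)$. Moreover, $z=\lim_{n\to\infty}\Pi_{(A+B)^{-1}(0)}(x_n)$ in norm, where $\Pi_C(x)$ denotes the generalized projection, the unique minimizer over $q\in C$ of $\phi(q,x)=\|q\|^2-2\langle q,Jx\rangle+\|x\|^2$. -/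

import Mathlib

open Filter Topology Set
open scoped NNReal

/-- The set `{f ∈ X* | ⟨f, x⟩ = ‖f‖² = ‖x‖²}`. -/
def dualitySet {X : Type*} [NormedAddCommGroup X] [NormedSpace ℝ X] (x : X) :
    Set (StrongDual ℝ X) :=
  {f | f x = ‖f‖ ^ 2 ∧ ‖f‖ ^ 2 = ‖x‖ ^ 2}

theorem dualitySet_nonempty {X : Type*} [NormedAddCommGroup X] [NormedSpace ℝ X] (x : X) :
    (dualitySet x).Nonempty := by
  by_cases hx : ‖x‖ = 0
  · refine ⟨0, ?_, ?_⟩ <;> simp [hx]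
  · obtain ⟨g, hg, hgx⟩ := exists_dual_vector ℝ x hx
    refine ⟨‖x‖ • g, ?_, ?_⟩
    · simp [norm_smul, hg, hgx, sq]
    · simp [norm_smul, hg]

/-- The normalized duality mapping `J : X → X*` as a single-valued map. In a smooth space, `J x` is
the only element of `dualitySet x`; in general it is a selection. -/
noncomputable def dualityMapping {X : Type*} [NormedAddCommGroup X] [NormedSpace ℝ X] (x : X) :
    StrongDual ℝ X :=
  (dualitySet_nonempty x).some

theorem dualityMapping_mem {X : Type*} [NormedAddCommGroup X] [NormedSpace ℝ X] (x : X) :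
    dualityMapping x ∈ dualitySet x :=
  (dualitySet_nonempty x).some_mem

/-- 2-uniform convexity: for some `c > 0` the modulus of convexity, the infimum over `x, y` in the
closed unit ball with `‖x - y‖ ≥ ε` of `1 - ‖(x + y) / 2‖`, is at least `c ε²` for all
`ε ∈ [0, 2]`. -/
def TwoUniformlyConvex (X : Type*) [NormedAddCommGroup X] [NormedSpace ℝ X] : Prop :=
  ∃ c : ℝ, 0 < c ∧ ∀ ε ∈ Icc (0 : ℝ) 2, ∀ x y : X, ‖x‖ ≤ 1 → ‖y‖ ≤ 1 → ε ≤ ‖x - y‖ →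
    c * ε ^ 2 ≤ 1 - ‖(2⁻¹ : ℝ) • (x + y)‖

/-- Uniform smoothness: `(‖x + t y‖ - ‖x‖) / t` converges as `t → 0`, uniformly for `x, y` in the
unit sphere. -/
def UniformlySmooth (X : Type*) [NormedAddCommGroup X] [NormedSpace ℝ X] : Prop :=
  ∃ g : X × X → ℝ,
    TendstoUniformlyOn (fun (t : ℝ) (p : X × X) => (‖p.1 + t • p.2‖ - ‖p.1‖) / t) g (𝓝[≠] 0)
      (Metric.sphere (0 : X) 1 ×ˢ Metric.sphere (0 : X) 1)

/-- `μ` is the 2-uniform convexity constant of `X`: the least `m ≥ 1` with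
`(‖x + y‖² + ‖x - y‖²) / 2 ≥ ‖x‖² + m⁻¹ ‖y‖²` for all `x, y`. -/
def IsTwoUniformConvexityConstant (X : Type*) [NormedAddCommGroup X] [NormedSpace ℝ X]
    (μ : ℝ) : Prop :=
  IsLeast {m : ℝ | 1 ≤ m ∧ ∀ x y : X,
    ‖x‖ ^ 2 + m⁻¹ * ‖y‖ ^ 2 ≤ (‖x + y‖ ^ 2 + ‖x - y‖ ^ 2) / 2} μ

/-- `κ > 0` is a 2-uniform smoothness constant of `X`:
`‖x + y‖² ≤ ‖x‖² + 2 ⟨y, J x⟩ + 2 κ² ‖y‖²` for all `x, y`. -/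
def IsTwoUniformSmoothnessConstant (X : Type*) [NormedAddCommGroup X] [NormedSpace ℝ X]
    (κ : ℝ) : Prop :=
  0 < κ ∧ ∀ x y : X,
    ‖x + y‖ ^ 2 ≤ ‖x‖ ^ 2 + 2 * dualityMapping x y + 2 * κ ^ 2 * ‖y‖ ^ 2

section BanachSpace

variable {E : Type*} [NormedAddCommGroup E] [NormedSpace ℝ E]

/-- Weak convergence of a sequence in `E`. -/
def WeaklyConvergesTo (x : ℕ → E) (z : E) : Prop :=
  Tendsto (fun n => toWeakSpace ℝ E (x n)) atTop (𝓝 (toWeakSpace ℝ E z))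

/-- Weak-* convergence of a sequence in the dual of `E`. -/
def WeakStarConvergesTo (f : ℕ → StrongDual ℝ E) (g : StrongDual ℝ E) : Prop :=
  Tendsto (fun n => StrongDual.toWeakDual (f n)) atTop (𝓝 (StrongDual.toWeakDual g))

/-- `J` maps weakly convergent sequences of `E` to weak-* convergent sequences of `E*`. -/
def DualityWeaklySequentiallyContinuous (E : Type*) [NormedAddCommGroup E]
    [NormedSpace ℝ E] : Prop :=
  ∀ (x : ℕ → E) (z : E), WeaklyConvergesTo x z →
    WeakStarConvergesTo (fun n => dualityMapping (x n)) (dualityMapping z)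

/-- Monotonicity of a single-valued operator `A : E → E*`. -/
def MonotoneMap (A : E → StrongDual ℝ E) : Prop :=
  ∀ x y : E, 0 ≤ (A x - A y) (x - y)

/-- Monotonicity of a multi-valued operator `B : E → 2^{E*}`. -/
def MonotoneOperator (B : E → Set (StrongDual ℝ E)) : Prop :=
  ∀ x y : E, ∀ f ∈ B x, ∀ g ∈ B y, 0 ≤ (f - g) (x - y)

/-- A monotone operator whose graph lies in no larger graph of a monotone operator. -/
def MaximalMonotoneOperator (B : E → Set (StrongDual ℝ E)) : Prop :=
  MonotoneOperator B ∧
    ∀ S : E → Set (StrongDual ℝ E), MonotoneOperator S → (∀ x, B x ⊆ S x) → B = S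

/-- The solution set `(A + B)⁻¹(0) = {x | 0 ∈ A x + B x}`. -/
def zeroSet (A : E → StrongDual ℝ E) (B : E → Set (StrongDual ℝ E)) : Set E :=
  {x | ∃ v ∈ B x, A x + v = 0}

/-- `φ(x, y) = ‖x‖² - 2 ⟨x, J y⟩ + ‖y‖²`. -/
noncomputable def lyapunov (x y : E) : ℝ :=
  ‖x‖ ^ 2 - 2 * dualityMapping y x + ‖y‖ ^ 2

/-- `p` is a generalized projection of `x` onto `C`: a minimizer of `φ(·, x)` over `C`. -/
def IsGeneralizedProjection (C : Set E) (x p : E) : Prop :=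
  p ∈ C ∧ ∀ q ∈ C, lyapunov p x ≤ lyapunov q x

/-- `y = (J + t B)⁻¹ (J x - t A x)`, that is, `J x - t A x ∈ J y + t B y`. -/
def IsForwardBackwardPoint (A : E → StrongDual ℝ E) (B : E → Set (StrongDual ℝ E))
    (t : ℝ) (x y : E) : Prop :=
  ∃ v ∈ B y, dualityMapping x - t • A x = dualityMapping y + t • v

/-- The steps `t ∈ {γ, γ l, γ l², …}` that pass the line search test at `x`:
`t ‖A x - A y‖ ≤ θ ‖x - y‖` for the forward-backward point `y` with step `t`. -/
def acceptedSteps (A : E → StrongDual ℝ E) (B : E → Set (StrongDual ℝ E))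
    (γ l θ : ℝ) (x : E) : Set ℝ :=
  {t | (∃ k : ℕ, t = γ * l ^ k) ∧
    ∃ y, IsForwardBackwardPoint A B t x y ∧ t * ‖A x - A y‖ ≤ θ * ‖x - y‖}

/-- The sequences `x`, `y`, `stp` (step sizes) are generated by the forward-backward-forward
algorithm with line search, from the starting point `x 0`. The last clause says
`x (n + 1) = J⁻¹ (J (y n) - stp n (A (y n) - A (x n)))`. If the algorithm stops at step `n`, because
`x n = y n`, the recursion continues it by `x m = x n` for all `m ≥ n`. -/
def GeneratedByLineSearch (A : E → StrongDual ℝ E) (B : E → Set (StrongDual ℝ E))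
    (γ l θ : ℝ) (x y : ℕ → E) (stp : ℕ → ℝ) : Prop :=
  ∀ n : ℕ,
    IsGreatest (acceptedSteps A B γ l θ (x n)) (stp n) ∧
    IsForwardBackwardPoint A B (stp n) (x n) (y n) ∧
    dualityMapping (x (n + 1)) =
      dualityMapping (y n) - stp n • (A (y n) - A (x n))

end BanachSpace

/-! Write `c = μ⁻¹` and φ = `lyapunov`. The convexity inequality gives `c‖x - y‖² ≤ φ(x, y)`
(`QuadraticallyConvexNorm.le_lyapunov`), so `J` is strongly monotone. For every zero `u` of `A + B`,
one step of the algorithm gives `φ(u, xₙ₊₁) ≤ φ(u, xₙ) - (c - 2κ²θ²)‖xₙ - yₙ‖²`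
(`lyapunov_le_of_forward_backward_forward`), and the bound on `θ` makes the coefficient positive.
Hence `φ(u, xₙ)` decreases, `(xₙ)` is bounded and `‖xₙ - yₙ‖ → 0`.

By reflexivity `(xₙ)` has weak cluster points. The Lipschitz bound keeps the steps away from 0, so
the inclusion defining `yₙ` passes to the limit and each cluster point is a zero
(`mem_zeroSet_of_weak_limit`). Weak continuity of `J` makes the cluster point unique, by an
Opial-type argument. The projections form a Cauchy sequence by strong convexity of φ in its first
variable; weak continuity of `J` identifies their limit.

The supporting theory is proved on the way: reflexivity from the convexity inequality, surjectivity
of `J + tB`, and a Minty description of the zero set. -/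

/-! ### Reflexivity and weak sequential compactness. -/

section Reflexivity

set_option maxSynthPendingDepth 3

variable {X : Type*} [NormedAddCommGroup X] [NormedSpace ℝ X]

/-- The inequality `‖x‖² + c ‖y‖² ≤ (‖x + y‖² + ‖x - y‖²) / 2`, with modulus `c`. -/
def QuadraticallyConvexNorm (X : Type*) [NormedAddCommGroup X] [NormedSpace ℝ X] (c : ℝ) : Prop :=
  ∀ x y : X, ‖x‖ ^ 2 + c * ‖y‖ ^ 2 ≤ (‖x + y‖ ^ 2 + ‖x - y‖ ^ 2) / 2

theorem QuadraticallyConvexNorm.midpoint {c : ℝ} (h : QuadraticallyConvexNorm X c) (p q : X) :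
    ‖(2⁻¹ : ℝ) • (p + q)‖ ^ 2 + c / 4 * ‖p - q‖ ^ 2 ≤ (‖p‖ ^ 2 + ‖q‖ ^ 2) / 2 := by
  have := h ((2⁻¹ : ℝ) • (p + q)) ((2⁻¹ : ℝ) • (p - q))
  have e1 : (2⁻¹ : ℝ) • (p + q) + (2⁻¹ : ℝ) • (p - q) = p := by module
  have e2 : (2⁻¹ : ℝ) • (p + q) - (2⁻¹ : ℝ) • (p - q) = q := by module
  rw [e1, e2, norm_smul (2⁻¹ : ℝ) (p - q), mul_pow] at this
  norm_num at this ⊢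
  linarith

theorem QuadraticallyConvexNorm.submodule {c : ℝ} (h : QuadraticallyConvexNorm X c)
    (M : Submodule ℝ X) : QuadraticallyConvexNorm M c :=
  fun x y => h x y

theorem real_le_norm_apply (f : StrongDual ℝ X) (x : X) : f x ≤ ‖f‖ * ‖x‖ :=
  (le_abs_self _).trans (f.le_opNorm x)

/-- Helly's lemma: an element of the bidual is approximated on finitely many functionals by
elements of the unit ball. -/
theorem exists_closedBall_approx (F : StrongDual ℝ (StrongDual ℝ X)) (hF : ‖F‖ ≤ 1)
    (s : Finset (StrongDual ℝ X)) {ε : ℝ} (hε : 0 < ε) :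
    ∃ x : X, ‖x‖ ≤ 1 ∧ ∀ f ∈ s, |f x - F f| < ε := by
  classical
  let T : X →ₗ[ℝ] (s → ℝ) := LinearMap.pi fun i => (i : StrongDual ℝ X).toLinearMap
  let v : s → ℝ := fun i => F i
  -- Otherwise Hahn–Banach in finite dimension yields a combination `g` of the functionals with `‖g‖
  -- ≤ u < F g`, against `‖F‖ ≤ 1`.
  have hv : v ∈ closure (T '' Metric.closedBall 0 1) := by
    by_contra hv
    obtain ⟨φ, u, h1, h2⟩ := geometric_hahn_banach_closed_point
      (((convex_closedBall (0 : X) 1).linear_image T).closure) isClosed_closure hv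
    have hφ : ∀ w : s → ℝ, φ w = ∑ i, w i * φ (Pi.single i 1) := by
      intro w
      conv_lhs => rw [pi_eq_sum_univ' w]
      rw [map_sum]
      refine Finset.sum_congr rfl fun i _ => ?_
      rw [map_smul, smul_eq_mul]
    let g : StrongDual ℝ X := ∑ i : s, φ (Pi.single i 1) • (i : StrongDual ℝ X)
    have hg : ∀ x, g x = φ (T x) := by
      intro x
      rw [hφ]
      simp [g, T, mul_comm]
    have hFg : F g = φ v := by
      rw [hφ]
      simp [g, v, mul_comm]
    have hgu : ∀ x : X, ‖x‖ ≤ 1 → g x ≤ u := fun x hx => by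
      rw [hg]
      exact (h1 _ (subset_closure ⟨x, by simpa using hx, rfl⟩)).le
    have hu0 : 0 ≤ u := by simpa using hgu 0 (by simp)
    have hgn : ‖g‖ ≤ u := by
      refine ContinuousLinearMap.opNorm_le_of_unit_norm hu0 fun x hx => ?_
      rw [Real.norm_eq_abs, abs_le]
      have := hgu (-x) (by simp [hx])
      rw [map_neg] at this
      exact ⟨by linarith, hgu x hx.le⟩
    have h3 := real_le_norm_apply F g
    nlinarith [norm_nonneg F, norm_nonneg g]
  rw [Metric.mem_closure_iff] at hv
  obtain ⟨_, ⟨x, hx, rfl⟩, hd⟩ := hv ε hε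
  refine ⟨x, by simpa using hx, fun f hf => ?_⟩
  have := (dist_pi_lt_iff hε).1 hd ⟨f, hf⟩
  rw [dist_comm, Real.dist_eq] at this
  exact this

/-- The Milman–Pettis theorem for a norm of power type 2. -/
theorem QuadraticallyConvexNorm.exists_eval_eq [CompleteSpace X] {c : ℝ} (hc : 0 < c)
    (h : QuadraticallyConvexNorm X c) (F : StrongDual ℝ (StrongDual ℝ X)) :
    ∃ x : X, ∀ f, F f = f x := by
  classical
  wlog hF : ‖F‖ = 1 generalizing F
  · by_cases h0 : F = 0
    · exact ⟨0, by simp [h0]⟩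
    have hn : ‖F‖ ≠ 0 := norm_ne_zero_iff.2 h0
    obtain ⟨x, hx⟩ := this (‖F‖⁻¹ • F) (norm_smul_inv_norm (𝕜 := ℝ) h0)
    refine ⟨‖F‖ • x, fun f => ?_⟩
    have := hx f
    simp only [smul_apply, smul_eq_mul] at this
    rw [map_smul, smul_eq_mul, ← this]
    field_simp
  have key : ∀ p : Finset (StrongDual ℝ X) × ℕ, ∃ x : X, ‖x‖ ≤ 1 ∧
      ∀ f ∈ p.1, |f x - F f| < 1 / ((p.2 : ℝ) + 1) :=
    fun p => exists_closedBall_approx F hF.le p.1 Nat.one_div_pos_of_nat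
  choose a ha1 ha2 using key
  have hlim : ∀ f, Tendsto (fun p => f (a p)) atTop (𝓝 (F f)) := by
    intro f
    rw [Metric.tendsto_atTop]
    intro ε hε
    obtain ⟨N, hN⟩ := exists_nat_one_div_lt hε
    refine ⟨({f}, N), fun p hp => ?_⟩
    rw [Real.dist_eq]
    refine (ha2 p f (hp.1 (by simp))).trans (lt_of_le_of_lt ?_ hN)
    have : (N : ℝ) ≤ p.2 := by exact_mod_cast hp.2
    gcongr
  have hcau : CauchySeq a := by
    rw [Metric.cauchySeq_iff]
    intro ε hε
    -- Chosen so that `2δ = (c / 4)(ε / 2)²`: midpoints of norm above `1 - δ` force the points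
    -- within `ε / 2`.
    set δ : ℝ := c * ε ^ 2 / 32 with hδ
    have hδ0 : 0 < δ := by positivity
    obtain ⟨f, hf1, hf2⟩ : ∃ f : StrongDual ℝ X, ‖f‖ ≤ 1 ∧ 1 - δ < F f := by
      by_contra! hcon
      have : ‖F‖ ≤ max (1 - δ) 0 := by
        refine ContinuousLinearMap.opNorm_le_of_unit_norm (le_max_right _ _) fun f hf => ?_
        rw [Real.norm_eq_abs, abs_le]
        have h1 := hcon f hf.le
        have h2 := hcon (-f) (by simp [hf])
        rw [map_neg] at h2
        exact ⟨by linarith [le_max_left (1 - δ) 0], h1.trans (le_max_left _ _)⟩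
      rw [hF] at this
      rcases le_max_iff.1 this with h1 | h1 <;> linarith
    obtain ⟨N, hN⟩ := (eventually_atTop.1 ((hlim f).eventually (lt_mem_nhds hf2)))
    refine ⟨N, fun p hp q hq => ?_⟩
    rw [dist_eq_norm]
    have h1 := hN p hp
    have h2 := hN q hq
    have h3 : 1 - δ < ‖(2⁻¹ : ℝ) • (a p + a q)‖ := by
      have h4 := real_le_norm_apply f ((2⁻¹ : ℝ) • (a p + a q))
      have h5 : ‖f‖ * ‖(2⁻¹ : ℝ) • (a p + a q)‖ ≤ 1 * ‖(2⁻¹ : ℝ) • (a p + a q)‖ := by gcongr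
      rw [map_smul, map_add, smul_eq_mul] at h4
      linarith
    have h4 := h.midpoint (a p) (a q)
    have h5 : ‖a p‖ ^ 2 ≤ 1 := pow_le_one₀ (norm_nonneg _) (ha1 p)
    have h6 : ‖a q‖ ^ 2 ≤ 1 := pow_le_one₀ (norm_nonneg _) (ha1 q)
    have h7 : 1 - 2 * δ ≤ ‖(2⁻¹ : ℝ) • (a p + a q)‖ ^ 2 := by
      nlinarith [norm_nonneg ((2⁻¹ : ℝ) • (a p + a q)), sq_nonneg (‖(2⁻¹ : ℝ) • (a p + a q)‖ - 1)]
    have h8 : c / 4 * ‖a p - a q‖ ^ 2 ≤ c / 4 * (ε / 2) ^ 2 := by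
      have : c / 4 * (ε / 2) ^ 2 = 2 * δ := by rw [hδ]; ring
      linarith
    have h9 := le_of_mul_le_mul_left h8 (by positivity)
    have := abs_le_of_sq_le_sq h9 (by positivity)
    linarith [le_abs_self ‖a p - a q‖, abs_norm (a p - a q)]
  obtain ⟨x, hx⟩ := cauchySeq_tendsto_of_complete hcau
  exact ⟨x, fun f => tendsto_nhds_unique (hlim f) ((f.continuous.tendsto x).comp hx)⟩

/-- Choose vectors that half-norm a dense sequence of functionals. A nonzero functional vanishing on
all of them would stay away from that sequence, so their span is dense. -/
theorem separableSpace_of_separableSpace_dual [TopologicalSpace.SeparableSpace (StrongDual ℝ X)] :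
    TopologicalSpace.SeparableSpace X := by
  let d := TopologicalSpace.denseSeq (StrongDual ℝ X)
  have hx : ∀ n, ∃ x : X, ‖x‖ ≤ 1 ∧ ‖d n‖ / 2 ≤ |d n x| := by
    intro n
    by_contra! hcon
    have : ‖d n‖ ≤ ‖d n‖ / 2 :=
      ContinuousLinearMap.opNorm_le_of_unit_norm (by positivity) fun x hx => (hcon x hx.le).le
    have := hcon 0 (by simp)
    simp only [map_zero, abs_zero] at this
    linarith
  choose a ha1 ha2 using hx
  have htop : (Submodule.span ℝ (range a)).topologicalClosure = ⊤ := by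
    rw [Submodule.eq_top_iff']
    intro x
    by_contra hx
    obtain ⟨f, u, h1, h2⟩ := geometric_hahn_banach_closed_point
      (Submodule.convex (Submodule.span ℝ (range a)).topologicalClosure)
      (Submodule.isClosed_topologicalClosure _) hx
    have hfa : ∀ n, f (a n) = 0 := by
      intro n
      by_contra hn
      have hmem : (u / f (a n)) • a n ∈ (Submodule.span ℝ (range a)).topologicalClosure :=
        Submodule.smul_mem _ _ (Submodule.le_topologicalClosure _
          (Submodule.subset_span (mem_range_self n)))
      have := h1 _ hmem
      rw [map_smul, smul_eq_mul, div_mul_cancel₀ _ hn] at this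
      exact lt_irrefl _ this
    have hu : 0 < u := by simpa using h1 0 (Submodule.zero_mem _)
    have hf : 0 < ‖f‖ := norm_pos_iff.2 (by rintro rfl; simp at h2; linarith)
    obtain ⟨n, hn⟩ := (TopologicalSpace.denseRange_denseSeq (StrongDual ℝ X)).exists_dist_lt
      f (show 0 < ‖f‖ / 4 by positivity)
    rw [dist_eq_norm] at hn
    change ‖f - d n‖ < _ at hn
    have h3 : |d n (a n)| ≤ ‖f - d n‖ := by
      have := (f - d n).le_opNorm (a n)
      rw [sub_apply, hfa, zero_sub, norm_neg, Real.norm_eq_abs] at this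
      exact this.trans (mul_le_of_le_one_right (norm_nonneg _) (ha1 n))
    have h4 := ha2 n
    have h5 : ‖f‖ ≤ ‖f - d n‖ + ‖d n‖ := by simpa using norm_add_le (f - d n) (d n)
    linarith
  have hs : TopologicalSpace.IsSeparable (univ : Set X) := by
    have := ((countable_range a).isSeparable.span (R := ℝ)).closure
    rw [← Submodule.topologicalClosure_coe, htop] at this
    simpa using this
  exact TopologicalSpace.isSeparable_univ_iff.1 hs

/-- The closed span `M` of the sequence is separable and reflexive, so its bidual, and then its
dual, is separable. Balls of the bidual are therefore weak-* sequentially compact, and reflexivity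
brings the limit back to `M`. -/
theorem QuadraticallyConvexNorm.exists_subseq_tendsto [CompleteSpace X] {c : ℝ} (hc : 0 < c)
    (h : QuadraticallyConvexNorm X c) (x : ℕ → X) {R : ℝ} (hx : ∀ n, ‖x n‖ ≤ R) :
    ∃ (z : X) (s : ℕ → ℕ), StrictMono s ∧
      ∀ f : StrongDual ℝ X, Tendsto (fun n => f (x (s n))) atTop (𝓝 (f z)) := by
  let M := (Submodule.span ℝ (range x)).topologicalClosure
  have hM : QuadraticallyConvexNorm M c := h.submodule M
  have hMc : IsClosed (M : Set X) := Submodule.isClosed_topologicalClosure _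
  have : CompleteSpace M := hMc.completeSpace_coe
  have hMs : TopologicalSpace.SeparableSpace M := by
    have := ((countable_range x).isSeparable.span (R := ℝ)).closure
    rw [← Submodule.topologicalClosure_coe] at this
    exact this.separableSpace
  have hbid : TopologicalSpace.SeparableSpace (StrongDual ℝ (StrongDual ℝ M)) := by
    have hsurj : Function.Surjective (NormedSpace.inclusionInDoubleDual ℝ M) := fun F => by
      obtain ⟨z, hz⟩ := hM.exists_eval_eq hc F
      exact ⟨z, ContinuousLinearMap.ext fun f => (hz f).symm⟩
    exact hsurj.denseRange.separableSpace (NormedSpace.inclusionInDoubleDual ℝ M).continuous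
  have hdual : TopologicalSpace.SeparableSpace (StrongDual ℝ M) :=
    separableSpace_of_separableSpace_dual (X := StrongDual ℝ M)
  have hmem : ∀ n, x n ∈ M := fun n =>
    Submodule.le_topologicalClosure _ (Submodule.subset_span (mem_range_self n))
  let a : ℕ → WeakDual ℝ (StrongDual ℝ M) := fun n =>
    StrongDual.toWeakDual (NormedSpace.inclusionInDoubleDual ℝ M ⟨x n, hmem n⟩)
  have ha : ∀ n, a n ∈ WeakDual.toStrongDual ⁻¹'
      Metric.closedBall (0 : StrongDual ℝ (StrongDual ℝ M)) R := by
    intro n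
    rw [mem_preimage, mem_closedBall_zero_iff]
    exact (NormedSpace.double_dual_bound ℝ M ⟨x n, hmem n⟩).trans (hx n)
  obtain ⟨F, -, s, hs, hlim⟩ := WeakDual.isSeqCompact_closedBall ℝ (StrongDual ℝ M) 0 R ha
  obtain ⟨z, hz⟩ := hM.exists_eval_eq hc (WeakDual.toStrongDual F)
  refine ⟨z, s, hs, fun f => ?_⟩
  have h1 := tendsto_iff_forall_eval_tendsto_topDualPairing.1 hlim (f.comp M.subtypeL)
  have h2 := hz (f.comp M.subtypeL)
  change Tendsto (fun n => f (x (s n))) atTop (𝓝 (WeakDual.toStrongDual F (f.comp M.subtypeL))) at h1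
  rw [h2] at h1
  exact h1

end Reflexivity

/-! ### Duality mapping, Lyapunov functional and maximal monotone graphs. -/

section DualityMapping

set_option maxSynthPendingDepth 3

variable {X : Type*} [NormedAddCommGroup X] [NormedSpace ℝ X]

theorem dualityMapping_apply_self (x : X) : dualityMapping x x = ‖x‖ ^ 2 :=
  (dualityMapping_mem x).1.trans (dualityMapping_mem x).2

theorem norm_dualityMapping (x : X) : ‖dualityMapping x‖ = ‖x‖ :=
  (sq_eq_sq₀ (norm_nonneg _) (norm_nonneg _)).1 (dualityMapping_mem x).2

/-- The value `f y / ‖x‖` lies between the left and right difference quotients of the norm at `x /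
‖x‖`, which have the same limit. -/
theorem UniformlySmooth.eq_dualityMapping (h : UniformlySmooth X) {x : X} {f : StrongDual ℝ X}
    (hf : f ∈ dualitySet x) : f = dualityMapping x := by
  obtain ⟨G, hG⟩ := h
  rcases eq_or_ne x 0 with rfl | hx
  · have h1 : ‖f‖ = 0 := by simpa using hf.2
    have h2 : ‖dualityMapping (0 : X)‖ = 0 := by simp [norm_dualityMapping]
    rw [norm_eq_zero.1 h1, norm_eq_zero.1 h2]
  have hr : 0 < ‖x‖ := norm_pos_iff.2 hx
  have key : ∀ f ∈ dualitySet x, ∀ y : X, ‖y‖ = 1 → f y / ‖x‖ = G (‖x‖⁻¹ • x, y) := by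
    intro f hf y hy
    have hfn : ‖f‖ = ‖x‖ := (sq_eq_sq₀ (norm_nonneg _) (norm_nonneg _)).1 hf.2
    have he : ‖‖x‖⁻¹ • x‖ = 1 := norm_smul_inv_norm (𝕜 := ℝ) hx
    have hlim := hG.tendsto_at (x := (‖x‖⁻¹ • x, y)) ⟨by simpa using he, by simpa using hy⟩
    simp only [he] at hlim
    have hsub : ∀ t : ℝ, t * (f y / ‖x‖) ≤ ‖‖x‖⁻¹ • x + t • y‖ - 1 := by
      intro t
      have h1 := real_le_norm_apply f (‖x‖⁻¹ • x + t • y)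
      rw [map_add, map_smul, map_smul, smul_eq_mul, smul_eq_mul, hf.1, hfn] at h1
      have h2 : ‖x‖⁻¹ * ‖x‖ ^ 2 = ‖x‖ := by field_simp
      rw [h2] at h1
      rw [← mul_div_assoc, div_le_iff₀ hr]
      linarith
    have hR := hlim.mono_left (nhdsWithin_mono 0 (fun t (ht : 0 < t) => ht.ne') :
      𝓝[>] (0 : ℝ) ≤ 𝓝[≠] 0)
    have hLft := hlim.mono_left (nhdsWithin_mono 0 (fun t (ht : t < 0) => ht.ne) :
      𝓝[<] (0 : ℝ) ≤ 𝓝[≠] 0)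
    refine le_antisymm (ge_of_tendsto hR ?_) (le_of_tendsto hLft ?_)
    · filter_upwards [self_mem_nhdsWithin] with t (ht : 0 < t)
      rw [le_div_iff₀ ht]
      linarith [hsub t]
    · filter_upwards [self_mem_nhdsWithin] with t (ht : t < 0)
      rw [div_le_iff_of_neg ht]
      linarith [hsub t]
  ext y
  rcases eq_or_ne y 0 with rfl | hy
  · simp
  have hy1 : ‖‖y‖⁻¹ • y‖ = 1 := norm_smul_inv_norm (𝕜 := ℝ) hy
  have hyn : ‖y‖ ≠ 0 := norm_ne_zero_iff.2 hy
  have := (key f hf _ hy1).trans (key _ (dualityMapping_mem x) _ hy1).symm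
  rw [map_smul, map_smul, smul_eq_mul, smul_eq_mul] at this
  field_simp at this
  exact this

/-- Two support functionals of the squared norm differ on `t • y` by at most `O(t²)`; divide by `t`
and let `t → 0`. -/
theorem IsTwoUniformSmoothnessConstant.eq_dualityMapping {κ : ℝ}
    (h : IsTwoUniformSmoothnessConstant X κ) {x : X} {f : StrongDual ℝ X}
    (hf : f ∈ dualitySet x) : f = dualityMapping x := by
  have key : ∀ y : X, f y ≤ dualityMapping x y := by
    intro y
    have hfn : ‖f‖ = ‖x‖ := (sq_eq_sq₀ (norm_nonneg _) (norm_nonneg _)).1 hf.2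
    have h1 : ∀ t > (0 : ℝ), f y - dualityMapping x y ≤ t * (κ ^ 2 * ‖y‖ ^ 2) := by
      intro t ht
      have h2 := h.2 x (t • y)
      have h3 := real_le_norm_apply f (x + t • y)
      rw [map_add, map_smul, smul_eq_mul, hf.1, hfn] at h3
      rw [map_smul, smul_eq_mul, norm_smul, mul_pow, Real.norm_eq_abs, sq_abs] at h2
      have h4 : t * (f y - dualityMapping x y) ≤ t * (t * (κ ^ 2 * ‖y‖ ^ 2)) := by
        nlinarith [sq_nonneg (‖x + t • y‖ - ‖x‖)]
      exact le_of_mul_le_mul_left h4 ht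
    have h2 : Tendsto (fun t : ℝ => t * (κ ^ 2 * ‖y‖ ^ 2)) (𝓝[>] 0) (𝓝 0) := by
      have : Tendsto (fun t : ℝ => t * (κ ^ 2 * ‖y‖ ^ 2)) (𝓝 0) (𝓝 (0 * (κ ^ 2 * ‖y‖ ^ 2))) :=
        tendsto_id.mul_const _
      rw [zero_mul] at this
      exact this.mono_left nhdsWithin_le_nhds
    have := ge_of_tendsto h2 (Filter.eventually_of_mem self_mem_nhdsWithin fun t ht => h1 t ht)
    linarith
  ext y
  have h1 := key (-y)
  rw [map_neg, map_neg] at h1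
  exact le_antisymm (key y) (by linarith)

theorem dualityMapping_dualityMapping_apply {κ : ℝ}
    (h : IsTwoUniformSmoothnessConstant (StrongDual ℝ X) κ) (x : X) (g : StrongDual ℝ X) :
    dualityMapping (dualityMapping x) g = g x := by
  have hn : ‖NormedSpace.inclusionInDoubleDual ℝ X x‖ = ‖x‖ :=
    (NormedSpace.inclusionInDoubleDualLi ℝ (E := X)).norm_map x
  have hmem : NormedSpace.inclusionInDoubleDual ℝ X x ∈ dualitySet (dualityMapping x) := by
    refine ⟨?_, ?_⟩
    · rw [NormedSpace.dual_def, dualityMapping_apply_self, hn]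
    · rw [hn, norm_dualityMapping]
  rw [← h.eq_dualityMapping hmem, NormedSpace.dual_def]

theorem QuadraticallyConvexNorm.le_lyapunov {c : ℝ} (h : QuadraticallyConvexNorm X c) (x y : X) :
    c * ‖x - y‖ ^ 2 ≤ lyapunov x y := by
  -- With `D d` the right-hand side, the midpoint inequality gives `D d ≥ 2 D (d / 2) + (c /
  -- 2)‖d‖²`. A lower bound with factor `a` thus improves to `(a + 1) / 2`, starting from `a = 0`.
  have key : ∀ (k : ℕ) (d : X), (1 - (1 / 2 : ℝ) ^ k) * (c * ‖d‖ ^ 2) ≤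
      ‖y + d‖ ^ 2 - ‖y‖ ^ 2 - 2 * dualityMapping y d := by
    intro k
    induction k with
    | zero =>
      intro d
      have h1 := real_le_norm_apply (dualityMapping y) (y + d)
      rw [map_add, dualityMapping_apply_self, norm_dualityMapping] at h1
      nlinarith [sq_nonneg (‖y + d‖ - ‖y‖)]
    | succ k ih =>
      intro d
      have h1 := ih ((2⁻¹ : ℝ) • d)
      have h2 := h.midpoint (y + d) y
      have e1 : (2⁻¹ : ℝ) • (y + d + y) = y + (2⁻¹ : ℝ) • d := by module
      have e2 : y + d - y = d := by abel
      rw [e1, e2] at h2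
      rw [map_smul, smul_eq_mul, norm_smul, mul_pow] at h1
      norm_num at h1 ⊢
      rw [pow_succ]
      nlinarith
  have hlim : Tendsto (fun k : ℕ => (1 - (1 / 2 : ℝ) ^ k) * (c * ‖x - y‖ ^ 2)) atTop
      (𝓝 ((1 - 0) * (c * ‖x - y‖ ^ 2))) :=
    ((tendsto_pow_atTop_nhds_zero_of_lt_one (by norm_num) (by norm_num)).const_sub 1).mul_const _
  have := le_of_tendsto' hlim fun k => key k (x - y)
  rw [add_sub_cancel, map_sub, dualityMapping_apply_self] at this
  rw [lyapunov]
  linarith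

theorem lyapunov_add_lyapunov (x y : X) :
    lyapunov x y + lyapunov y x = 2 * (dualityMapping x - dualityMapping y) (x - y) := by
  simp only [lyapunov, sub_apply, map_sub, dualityMapping_apply_self]
  ring

theorem QuadraticallyConvexNorm.le_dualityMapping_sub {c : ℝ} (h : QuadraticallyConvexNorm X c)
    (x y : X) : c * ‖x - y‖ ^ 2 ≤ (dualityMapping x - dualityMapping y) (x - y) := by
  have h1 := h.le_lyapunov x y
  have h2 := h.le_lyapunov y x
  rw [norm_sub_rev] at h2
  linarith [lyapunov_add_lyapunov x y]

/-- A maximal monotone graph meets the graph of `-J`. -/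
theorem exists_neg_dualityMapping_mem [CompleteSpace X] {c : ℝ} (hc : 0 < c)
    (h : QuadraticallyConvexNorm X c)
    (hsm : ∀ (x : X) (f : StrongDual ℝ X), f ∈ dualitySet x → f = dualityMapping x)
    (G : Set (X × StrongDual ℝ X)) (hmono : ∀ p ∈ G, ∀ q ∈ G, 0 ≤ (p.2 - q.2) (p.1 - q.1))
    (hmax : ∀ p, (∀ q ∈ G, 0 ≤ (p.2 - q.2) (p.1 - q.1)) → p ∈ G) :
    ∃ x, (x, -dualityMapping x) ∈ G := by
  have hGne : G.Nonempty := by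
    by_contra hne
    rw [not_nonempty_iff_eq_empty] at hne
    have := hmax 0 (by simp [hne])
    simp [hne] at this
  let N : X × StrongDual ℝ X → ℝ := fun p => (1 / 2 : ℝ) * (‖p.1‖ ^ 2 + ‖p.2‖ ^ 2)
  have hNconv : ConvexOn ℝ univ N := by
    have h1 : ConvexOn ℝ univ fun p : X × StrongDual ℝ X => ‖p.1‖ ^ 2 :=
      (convexOn_univ_norm.comp_linearMap (LinearMap.fst ℝ X (StrongDual ℝ X))).pow
        (fun _ _ => norm_nonneg _) 2
    have h2 : ConvexOn ℝ univ fun p : X × StrongDual ℝ X => ‖p.2‖ ^ 2 :=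
      (convexOn_univ_norm.comp_linearMap (LinearMap.snd ℝ X (StrongDual ℝ X))).pow
        (fun _ _ => norm_nonneg _) 2
    exact (h1.add h2).smul (by norm_num)
  have hNcont : Continuous N := by fun_prop
  -- `T` is the epigraph of the Fitzpatrick function of `G`. By maximality that function dominates
  -- the pairing, hence `-N`, so `S` and `T` can be separated.
  let S : Set ((X × StrongDual ℝ X) × ℝ) := {w | w.2 < -N w.1}
  have hSconv : Convex ℝ S := by
    simpa using hNconv.neg.convex_strict_hypograph
  have hSopen : IsOpen S := isOpen_lt (by fun_prop) (by fun_prop)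
  let T : Set ((X × StrongDual ℝ X) × ℝ) :=
    {w | ∀ q ∈ G, q.2 w.1.1 + w.1.2 q.1 - q.2 q.1 ≤ w.2}
  have hTconv : Convex ℝ T := by
    intro w hw w' hw' a b ha hb hab q hq
    have h1 := mul_le_mul_of_nonneg_left (hw q hq) ha
    have h2 := mul_le_mul_of_nonneg_left (hw' q hq) hb
    simp only [Prod.fst_add, Prod.snd_add, Prod.smul_fst, Prod.smul_snd, map_add, map_smul,
      add_apply, smul_apply, smul_eq_mul]
    have h3 : q.2 q.1 = a * q.2 q.1 + b * q.2 q.1 := by rw [← add_mul, hab, one_mul]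
    linarith
  have hdisj : Disjoint S T := by
    rw [Set.disjoint_left]
    rintro ⟨⟨x, f⟩, r⟩ hS hT
    have hr : r < f x := by
      have h1 : r < -N (x, f) := hS
      have h2 := real_le_norm_apply f (-x)
      rw [map_neg, norm_neg] at h2
      simp only [N] at h1
      nlinarith [sq_nonneg (‖x‖ - ‖f‖)]
    have hmem : (x, f) ∈ G := by
      refine hmax _ fun q hq => ?_
      have := hT q hq
      simp only [sub_apply, map_sub] at this ⊢
      linarith
    have := hT _ hmem
    simp only at this
    linarith
  obtain ⟨Φ, u, hΦS, hΦT⟩ := geometric_hahn_banach_open hSconv hSopen hTconv hdisj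
  let p : StrongDual ℝ X := Φ.comp ((ContinuousLinearMap.inl ℝ (X × StrongDual ℝ X) ℝ).comp
    (ContinuousLinearMap.inl ℝ X (StrongDual ℝ X)))
  let q : StrongDual ℝ (StrongDual ℝ X) :=
    Φ.comp ((ContinuousLinearMap.inl ℝ (X × StrongDual ℝ X) ℝ).comp
      (ContinuousLinearMap.inr ℝ X (StrongDual ℝ X)))
  let s : ℝ := Φ (0, 1)
  have hΦ : ∀ x f r, Φ ((x, f), r) = p x + q f + s * r := by
    intro x f r
    have e : ((x, f), r) = ((x, (0 : StrongDual ℝ X)), (0 : ℝ)) + (((0 : X), f), (0 : ℝ)) +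
        r • (((0 : X), (0 : StrongDual ℝ X)), (1 : ℝ)) := by simp
    rw [e, map_add, map_add, map_smul, smul_eq_mul, mul_comm]
    rfl
  have hGT : ∀ x f, (x, f) ∈ G → u ≤ p x + q f + s * f x := by
    intro x f hG
    rw [← hΦ]
    refine hΦT _ fun g hg => ?_
    have := hmono _ hG g hg
    simp only [sub_apply, map_sub] at this ⊢
    linarith
  have hs : 0 < s := by
    by_contra! hs
    obtain ⟨⟨x, f⟩, hG⟩ := hGne
    have h1 := hGT x f hG
    have h2 := hΦS ((x, f), min (f x) (-N (x, f) - 1))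
      (show min (f x) (-N (x, f) - 1) < -N (x, f) from (min_le_right _ _).trans_lt (sub_one_lt _))
    rw [hΦ] at h2
    have := mul_le_mul_of_nonpos_left (min_le_left (f x) (-N (x, f) - 1)) hs
    linarith
  obtain ⟨w, hw⟩ := h.exists_eval_eq hc (s⁻¹ • q)
  have hqw : ∀ f, q f = s * f w := by
    intro f
    rw [← hw f, smul_apply, smul_eq_mul, mul_inv_cancel_left₀ hs.ne']
  obtain ⟨P, hP⟩ : ∃ P : StrongDual ℝ X, ∀ x, p x = s * P x :=
    ⟨s⁻¹ • p, fun x => by rw [smul_apply, smul_eq_mul, mul_inv_cancel_left₀ hs.ne']⟩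
  have hA : ∀ x f, P x + f w - N (x, f) ≤ u / s := by
    intro x f
    rw [le_div_iff₀ hs]
    refine le_of_forall_pos_le_add fun ε hε => ?_
    have h1 := hΦS ((x, f), -N (x, f) - ε / s) (show -N (x, f) - ε / s < -N (x, f) from sub_lt_self _ (by positivity))
    rw [hΦ, hqw, hP, mul_sub, mul_div_cancel₀ _ hs.ne'] at h1
    linarith
  have hB : ∀ x f, (x, f) ∈ G → u / s ≤ P x + f w + f x := by
    intro x f hG
    rw [div_le_iff₀ hs]
    have := hGT x f hG
    rw [hqw, hP] at this
    linarith
  -- The left side is the conjugate of `N` at `(P, w)`; reflexivity supplies a vector at which `P`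
  -- attains it.
  have hu : (‖P‖ ^ 2 + ‖w‖ ^ 2) / 2 ≤ u / s := by
    obtain ⟨x, hx⟩ := h.exists_eval_eq hc (dualityMapping P)
    have h1 : P x = ‖P‖ ^ 2 := by rw [← hx, dualityMapping_apply_self]
    have h2 : ‖x‖ ≤ ‖P‖ := by
      refine NormedSpace.norm_le_dual_bound ℝ x (norm_nonneg _) fun f => ?_
      rw [← hx, ← norm_dualityMapping P]
      exact ContinuousLinearMap.le_opNorm _ _
    have h3 := hA x (dualityMapping w)
    simp only [N] at h3
    rw [h1, dualityMapping_apply_self, norm_dualityMapping] at h3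
    have := pow_le_pow_left₀ (norm_nonneg _) h2 2
    linarith
  have hPw := real_le_norm_apply P (-w)
  rw [map_neg, norm_neg] at hPw
  -- `hB` and `hu` give `(f + P)(x + w) ≥ 0` on `G`, so maximality applies. Testing `hB` at this new
  -- point then forces equality in `|P w| ≤ ‖P‖‖w‖`.
  have hmem : (-w, -P) ∈ G := by
    refine hmax _ fun g hg => ?_
    have := hB g.1 g.2 hg
    simp only [sub_apply, map_sub, map_neg, neg_apply]
    nlinarith [sq_nonneg (‖P‖ - ‖w‖)]
  have h1 := hB _ _ hmem
  simp only [map_neg, neg_apply] at h1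
  have hn : ‖P‖ = ‖w‖ := by nlinarith [sq_nonneg (‖P‖ - ‖w‖)]
  have hPJ : P = dualityMapping (-w) := by
    refine hsm _ _ ⟨?_, by rw [hn, norm_neg]⟩
    rw [map_neg]
    rw [hn] at hu hPw ⊢
    nlinarith
  exact ⟨-w, by rw [← hPJ]; exact hmem⟩

end DualityMapping

/-! ### Minimizers of strongly convex functions and convergence criteria. -/

section Minimization

variable {X : Type*} [NormedAddCommGroup X] [NormedSpace ℝ X]

/-- Midpoints stay in `C` and cannot go below the infimum, so a minimizing sequence is Cauchy. -/
theorem exists_forall_le_of_midpoint [CompleteSpace X] {h : X → ℝ} (hcont : Continuous h)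
    (h0 : ∀ x, 0 ≤ h x) {c : ℝ} (hc : 0 < c)
    (hmid : ∀ p q, h ((2⁻¹ : ℝ) • (p + q)) + c * ‖p - q‖ ^ 2 ≤ (h p + h q) / 2)
    {C : Set X} (hne : C.Nonempty) (hclosed : IsClosed C) (hconv : Convex ℝ C) :
    ∃ p ∈ C, ∀ q ∈ C, h p ≤ h q := by
  set d := sInf (h '' C) with hd
  have hbdd : BddBelow (h '' C) := ⟨0, by rintro _ ⟨x, -, rfl⟩; exact h0 x⟩
  have hdle : ∀ q ∈ C, d ≤ h q := fun q hq => csInf_le hbdd ⟨q, hq, rfl⟩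
  have hex : ∀ n : ℕ, ∃ q ∈ C, h q < d + 1 / ((n : ℝ) + 1) := by
    intro n
    obtain ⟨_, ⟨q, hq, rfl⟩, hlt⟩ := exists_lt_of_csInf_lt (hne.image h)
      (lt_add_of_pos_right d (Nat.one_div_pos_of_nat (n := n)))
    exact ⟨q, hq, hlt⟩
  choose q hqC hq using hex
  have hb : Tendsto (fun n : ℕ => √(1 / ((n : ℝ) + 1) / c)) atTop (𝓝 0) := by
    have h1 : Tendsto (fun n : ℕ => 1 / ((n : ℝ) + 1) / c) atTop (𝓝 (0 / c)) :=
      tendsto_one_div_add_atTop_nhds_zero_nat.div_const c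
    rw [zero_div] at h1
    simpa [Function.comp_def] using (Real.continuous_sqrt.tendsto 0).comp h1
  have hcau : CauchySeq q := by
    refine cauchySeq_of_le_tendsto_0' _ (fun n m hnm => ?_) hb
    rw [dist_eq_norm]
    refine Real.le_sqrt_of_sq_le ?_
    rw [le_div_iff₀ hc]
    have h1 := hmid (q n) (q m)
    have h2 : (2⁻¹ : ℝ) • (q n + q m) ∈ C := by
      rw [smul_add]
      exact hconv (hqC n) (hqC m) (by norm_num) (by norm_num) (by norm_num)
    have h3 := hdle _ h2
    have h4 : 1 / ((m : ℝ) + 1) ≤ 1 / ((n : ℝ) + 1) := by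
      have : (n : ℝ) ≤ m := by exact_mod_cast hnm
      gcongr
    linarith [hq n, hq m]
  obtain ⟨p, hp⟩ := cauchySeq_tendsto_of_complete hcau
  refine ⟨p, hclosed.mem_of_tendsto hp (Eventually.of_forall hqC), fun a ha => ?_⟩
  have h1 : Tendsto (fun n : ℕ => d + 1 / ((n : ℝ) + 1)) atTop (𝓝 (d + 0)) :=
    tendsto_one_div_add_atTop_nhds_zero_nat.const_add d
  have h2 := le_of_tendsto_of_tendsto' ((hcont.tendsto p).comp hp) h1 fun n => (hq n).le
  linarith [hdle a ha]

theorem sq_norm_sub_le_of_midpoint {h : X → ℝ} {c : ℝ}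
    (hmid : ∀ p q, h ((2⁻¹ : ℝ) • (p + q)) + c * ‖p - q‖ ^ 2 ≤ (h p + h q) / 2)
    {C : Set X} (hconv : Convex ℝ C) {p q : X} (hp : p ∈ C) (hq : q ∈ C)
    (hmin : ∀ a ∈ C, h p ≤ h a) : 2 * c * ‖p - q‖ ^ 2 ≤ h q - h p := by
  have h2 : (2⁻¹ : ℝ) • (p + q) ∈ C := by
    rw [smul_add]
    exact hconv hp hq (by norm_num) (by norm_num) (by norm_num)
  linarith [hmid p q, hmin _ h2]

theorem cauchySeq_of_sq_norm_sub_le {Y : Type*} [NormedAddCommGroup Y] {u : ℕ → Y} {r : ℕ → ℝ} {c : ℝ} (hc : 0 < c)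
    (hr : Antitone r) (h0 : ∀ n, 0 ≤ r n)
    (h : ∀ n m, n ≤ m → c * ‖u m - u n‖ ^ 2 ≤ r n - r m) : CauchySeq u := by
  have hbdd : BddBelow (range r) := ⟨0, by rintro _ ⟨n, rfl⟩; exact h0 n⟩
  have hlim := tendsto_atTop_ciInf hr hbdd
  have hb : Tendsto (fun n : ℕ => √((r n - ⨅ i, r i) / c)) atTop (𝓝 0) := by
    have h1 := (hlim.sub_const (⨅ i, r i)).div_const c
    rw [sub_self, zero_div] at h1
    simpa [Function.comp_def] using (Real.continuous_sqrt.tendsto 0).comp h1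
  refine cauchySeq_of_le_tendsto_0' _ (fun n m hnm => ?_) hb
  rw [dist_comm, dist_eq_norm]
  refine Real.le_sqrt_of_sq_le ?_
  rw [le_div_iff₀ hc]
  linarith [h n m hnm, ciInf_le hbdd m]

theorem tendsto_zero_of_tendsto_sq {a : ℕ → ℝ} (h0 : ∀ n, 0 ≤ a n)
    (h : Tendsto (fun n => a n ^ 2) atTop (𝓝 0)) : Tendsto a atTop (𝓝 0) := by
  have := (Real.continuous_sqrt.tendsto 0).comp h
  simpa [Function.comp_def, Real.sqrt_sq (h0 _)] using this

theorem tendsto_apply_of_norm_le {f : ℕ → StrongDual ℝ X} {R : ℝ} (hf : ∀ n, ‖f n‖ ≤ R)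
    {u : ℕ → X} {p : X} {a : ℝ} (hu : Tendsto u atTop (𝓝 p))
    (h : Tendsto (fun n => f n p) atTop (𝓝 a)) : Tendsto (fun n => f n (u n)) atTop (𝓝 a) := by
  have h1 : Tendsto (fun n => R * ‖u n - p‖) atTop (𝓝 0) := by
    simpa using (tendsto_iff_norm_sub_tendsto_zero.1 hu).const_mul R
  have h2 : Tendsto (fun n => f n (u n - p)) atTop (𝓝 0) := by
    refine squeeze_zero_norm (fun n => ?_) h1
    exact ((f n).le_opNorm _).trans (by gcongr; exact hf n)
  have := h2.add h
  rw [zero_add] at this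
  exact this.congr fun n => by rw [map_sub, sub_add_cancel]

end Minimization

/-! ### Resolvents, the zero set and one step of the algorithm. -/

section ForwardBackwardForward

variable {E : Type*} [NormedAddCommGroup E] [NormedSpace ℝ E]

theorem weaklyConvergesTo_iff {x : ℕ → E} {z : E} : WeaklyConvergesTo x z ↔
    ∀ f : StrongDual ℝ E, Tendsto (fun n => f (x n)) atTop (𝓝 (f z)) := by
  refine WeakBilin.tendsto_iff_forall_eval_tendsto (topDualPairing ℝ E).flip fun a b hab => ?_
  refine (NormedSpace.inclusionInDoubleDualLi ℝ (E := E)).injective ?_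
  ext f
  exact DFunLike.congr_fun hab f

theorem weakStarConvergesTo_iff {f : ℕ → StrongDual ℝ E} {g : StrongDual ℝ E} :
    WeakStarConvergesTo f g ↔ ∀ x, Tendsto (fun n => f n x) atTop (𝓝 (g x)) :=
  tendsto_iff_forall_eval_tendsto_topDualPairing

theorem DualityWeaklySequentiallyContinuous.tendsto_apply
    (hJ : DualityWeaklySequentiallyContinuous E) {x : ℕ → E} {z : E}
    (hx : ∀ f : StrongDual ℝ E, Tendsto (fun n => f (x n)) atTop (𝓝 (f z))) (w : E) :
    Tendsto (fun n => dualityMapping (x n) w) atTop (𝓝 (dualityMapping z w)) :=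
  weakStarConvergesTo_iff.1 (hJ x z (weaklyConvergesTo_iff.2 hx)) w

theorem QuadraticallyConvexNorm.lyapunov_midpoint {c : ℝ} (h : QuadraticallyConvexNorm E c)
    (x p q : E) : lyapunov ((2⁻¹ : ℝ) • (p + q)) x + c / 4 * ‖p - q‖ ^ 2 ≤
      (lyapunov p x + lyapunov q x) / 2 := by
  have := h.midpoint p q
  simp only [lyapunov, map_smul, map_add, smul_eq_mul]
  linarith

theorem continuous_lyapunov (x : E) : Continuous fun q => lyapunov q x := by
  unfold lyapunov
  fun_prop

/-- Adjoining `(x, v)` to the graph keeps it monotone. -/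
theorem MaximalMonotoneOperator.mem_of_forall {B : E → Set (StrongDual ℝ E)}
    (hB : MaximalMonotoneOperator B) {x : E} {v : StrongDual ℝ E}
    (h : ∀ y, ∀ w ∈ B y, 0 ≤ (v - w) (x - y)) : v ∈ B x := by
  have hflip : ∀ (a b : E) (f g : StrongDual ℝ E), (f - g) (a - b) = (g - f) (b - a) := by
    intro a b f g
    rw [← neg_sub g f, ← neg_sub b a, map_neg, neg_apply, neg_neg]
  rw [hB.2 (fun y => B y ∪ {w | y = x ∧ w = v}) ?_ fun y => subset_union_left]
  · exact Or.inr ⟨rfl, rfl⟩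
  rintro a b f (hf | ⟨rfl, rfl⟩) g (hg | ⟨rfl, rfl⟩)
  · exact hB.1 a b f hf g hg
  · rw [hflip]
    exact h a f hf
  · exact h b g hg
  · simp

/-- Browder–Rockafellar: `J + t B` is onto. -/
theorem MaximalMonotoneOperator.exists_eq_dualityMapping_add [CompleteSpace E]
    {B : E → Set (StrongDual ℝ E)} (hB : MaximalMonotoneOperator B) {c : ℝ} (hc : 0 < c)
    (h : QuadraticallyConvexNorm E c)
    (hsm : ∀ (x : E) (f : StrongDual ℝ E), f ∈ dualitySet x → f = dualityMapping x)
    {t : ℝ} (ht : 0 < t) (f : StrongDual ℝ E) :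
    ∃ y, ∃ v ∈ B y, f = dualityMapping y + t • v := by
  have key : ∀ (a b : StrongDual ℝ E) (x : E),
      (t⁻¹ • (a + f) - t⁻¹ • (b + f)) x = t⁻¹ * (a - b) x := by
    intro a b x
    simp only [sub_apply, smul_apply, add_apply, smul_eq_mul]
    ring
  -- This is the graph of `t B - f`; meeting the graph of `-J` there solves the equation.
  have hmono : ∀ p ∈ {p : E × StrongDual ℝ E | t⁻¹ • (p.2 + f) ∈ B p.1},
      ∀ q ∈ {p : E × StrongDual ℝ E | t⁻¹ • (p.2 + f) ∈ B p.1}, 0 ≤ (p.2 - q.2) (p.1 - q.1) := by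
    intro p hp q hq
    have := hB.1 _ _ _ hp _ hq
    rw [key] at this
    exact nonneg_of_mul_nonneg_right this (by positivity)
  obtain ⟨x, hx⟩ := exists_neg_dualityMapping_mem hc h hsm _ hmono fun p hp => by
    refine hB.mem_of_forall fun y w hw => ?_
    have hw' : t⁻¹ • ((t • w - f) + f) = w := by
      rw [sub_add_cancel, smul_smul, inv_mul_cancel₀ ht.ne', one_smul]
    have h1 := hp (y, t • w - f) (by rw [mem_ofPred_eq, hw']; exact hw)
    have h2 := key p.2 (t • w - f) (p.1 - y)
    rw [hw'] at h2
    rw [h2]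
    exact mul_nonneg (by positivity) h1
  refine ⟨x, _, hx, ?_⟩
  rw [smul_smul, mul_inv_cancel₀ ht.ne', one_smul, add_neg_cancel_left]

variable {A : E → StrongDual ℝ E} {B : E → Set (StrongDual ℝ E)} {L : ℝ≥0}

theorem LipschitzWith.apply_sub_le (hL : LipschitzWith L A) (x y w : E) :
    (A x - A y) w ≤ L * ‖x - y‖ * ‖w‖ := by
  have h1 := hL.dist_le_mul x y
  rw [dist_eq_norm, dist_eq_norm] at h1
  exact (real_le_norm_apply _ _).trans (by gcongr)

/-- A Minty description, obtained without maximality of `A + B`: take a forward-backward point `w`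
of `z`; the inequality at `w` and strong monotonicity of `J` force `w = z`. It exhibits the zero set
as an intersection of closed half-spaces. -/
theorem mem_zeroSet_iff_forall_nonneg [CompleteSpace E] {c : ℝ} (hc : 0 < c)
    (h : QuadraticallyConvexNorm E c)
    (hsm : ∀ (x : E) (f : StrongDual ℝ E), f ∈ dualitySet x → f = dualityMapping x)
    (hA : MonotoneMap A) (hL : LipschitzWith L A) (hB : MaximalMonotoneOperator B) {z : E} :
    z ∈ zeroSet A B ↔ ∀ w, ∀ b ∈ B w, 0 ≤ (A w + b) (w - z) := by
  constructor
  · rintro ⟨v, hv, hz⟩ w b hb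
    have h1 := hA w z
    have h2 := hB.1 w z b hb v hv
    have h3 : (A z + v) (w - z) = 0 := by rw [hz]; rfl
    simp only [sub_apply, add_apply] at h1 h2 h3 ⊢
    linarith
  · intro hz
    -- Small enough that `t L < c`, so the Lipschitz error of `A` is absorbed by the strong
    -- monotonicity of `J`.
    set t : ℝ := c / (L + 1) with ht
    have hL0 : (0 : ℝ) < L + 1 := by positivity
    have ht0 : 0 < t := by positivity
    have htL : t * L < c := by
      have : t * (L + 1) = c := div_mul_cancel₀ _ hL0.ne'
      linarith
    obtain ⟨w, v, hv, hw⟩ := hB.exists_eq_dualityMapping_add hc h hsm ht0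
      (dualityMapping z - t • A z)
    have h1 := hz w v hv
    have h2 := h.le_dualityMapping_sub w z
    have h3 := hL.apply_sub_le w z (w - z)
    have h4 := DFunLike.congr_fun hw (w - z)
    simp only [sub_apply, add_apply, smul_apply, smul_eq_mul] at h1 h2 h3 h4
    have h5 : (c - t * L) * ‖w - z‖ ^ 2 ≤ 0 := by
      have h6 := mul_nonneg ht0.le h1
      have h7 := mul_le_mul_of_nonneg_left h3 ht0.le
      nlinarith
    have h6 : ‖w - z‖ ^ 2 = 0 :=
      le_antisymm (nonpos_of_mul_nonpos_right h5 (by linarith)) (sq_nonneg _)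
    have hwz : w = z := sub_eq_zero.1 (norm_eq_zero.1 (by simpa using h6))
    subst hwz
    refine ⟨v, hv, ?_⟩
    have h7 : t • (A w + v) = 0 := by
      have : t • (A w + v) = (dualityMapping w + t • v) - (dualityMapping w - t • A w) := by
        rw [smul_add]
        abel
      rw [this, hw, sub_self]
    exact (smul_eq_zero.1 h7).resolve_left ht0.ne'

theorem isClosed_zeroSet
    (h : ∀ z, z ∈ zeroSet A B ↔ ∀ w, ∀ b ∈ B w, 0 ≤ (A w + b) (w - z)) :
    IsClosed (zeroSet A B) := by
  have : zeroSet A B = ⋂ (w : E) (b ∈ B w), {z | 0 ≤ (A w + b) (w - z)} := by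
    ext z
    simp [h]
  rw [this]
  refine isClosed_iInter fun w => isClosed_biInter fun b _ => ?_
  exact isClosed_le continuous_const ((A w + b).continuous.comp (continuous_const.sub continuous_id))

theorem convex_zeroSet
    (h : ∀ z, z ∈ zeroSet A B ↔ ∀ w, ∀ b ∈ B w, 0 ≤ (A w + b) (w - z)) :
    Convex ℝ (zeroSet A B) := by
  intro p hp q hq a b ha hb hab
  rw [h] at hp hq ⊢
  intro w f hf
  have e : w - (a • p + b • q) = a • (w - p) + b • (w - q) := by
    have : w = (a + b) • w := by rw [hab, one_smul]
    nth_rewrite 1 [this]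
    module
  rw [e, map_add, map_smul, map_smul]
  exact add_nonneg (mul_nonneg ha (hp w f hf)) (mul_nonneg hb (hq w f hf))

theorem IsForwardBackwardPoint.unique {c : ℝ} (hc : 0 < c) (h : QuadraticallyConvexNorm E c)
    (hB : MonotoneOperator B) {t : ℝ} (ht : 0 < t) {x y y' : E}
    (hy : IsForwardBackwardPoint A B t x y) (hy' : IsForwardBackwardPoint A B t x y') :
    y = y' := by
  obtain ⟨v, hv, e⟩ := hy
  obtain ⟨v', hv', e'⟩ := hy'
  have h1 := DFunLike.congr_fun (e.symm.trans e') (y - y')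
  have h2 := h.le_dualityMapping_sub y y'
  have h3 := mul_nonneg ht.le (hB _ _ _ hv _ hv')
  simp only [sub_apply, add_apply, smul_apply, smul_eq_mul] at h1 h2 h3
  have h5 : c * ‖y - y'‖ ^ 2 ≤ 0 := by linarith
  have h6 : ‖y - y'‖ ^ 2 = 0 :=
    le_antisymm (nonpos_of_mul_nonpos_right h5 hc) (sq_nonneg _)
  exact sub_eq_zero.1 (norm_eq_zero.1 (by simpa using h6))

/-- Unless `t = γ`, the previous trial `t / l` was rejected, which by the Lipschitz bound needs `t /
l > θ / (L + 1)`; using `L + 1` covers `L = 0`. -/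
theorem le_of_isGreatest_acceptedSteps {γ l θ : ℝ} (hγ : 0 < γ) (hl : l ∈ Ioo (0 : ℝ) 1)
    (hL : LipschitzWith L A)
    (hex : ∀ t > 0, ∀ x, ∃ y, IsForwardBackwardPoint A B t x y) {x : E} {t : ℝ}
    (ht : IsGreatest (acceptedSteps A B γ l θ x) t) : min γ (l * θ / (L + 1)) ≤ t := by
  obtain ⟨⟨⟨k, rfl⟩, -⟩, hmax⟩ := ht
  rcases k with _ | k
  · simp
  refine (min_le_right _ _).trans ?_
  have hpos : 0 < γ * l ^ k := mul_pos hγ (pow_pos hl.1 k)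
  have hlt : γ * l ^ (k + 1) < γ * l ^ k := by
    rw [pow_succ, ← mul_assoc]
    exact mul_lt_of_lt_one_right hpos hl.2
  obtain ⟨y, hy⟩ := hex _ hpos x
  have h1 : θ * ‖x - y‖ < γ * l ^ k * ‖A x - A y‖ := by
    by_contra! hcon
    exact absurd (hmax ⟨⟨k, rfl⟩, y, hy, hcon⟩) (not_le.2 hlt)
  have h2 := hL.dist_le_mul x y
  rw [dist_eq_norm, dist_eq_norm] at h2
  have h3 : θ * ‖x - y‖ < γ * l ^ k * (L + 1) * ‖x - y‖ := by
    have := mul_le_mul_of_nonneg_left h2 hpos.le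
    have := mul_nonneg hpos.le (norm_nonneg (x - y))
    linarith
  have h4 := lt_of_mul_lt_mul_right h3 (norm_nonneg _)
  rw [div_le_iff₀ (by positivity), pow_succ]
  have := mul_le_mul_of_nonneg_left h4.le hl.1.le
  linarith

/-- Smoothness of the dual norm at `J y` bounds `‖J x'‖²`, with an error `2κ²θ²‖x - y‖²` after the
line search test. Monotonicity of `A` and `B` between `y` and `u` disposes of the cross terms, and
`φ(y, x) ≥ c‖x - y‖²` supplies the decrease. -/
theorem lyapunov_le_of_forward_backward_forward {c κ θ t : ℝ} (h : QuadraticallyConvexNorm E c)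
    (hκ : IsTwoUniformSmoothnessConstant (StrongDual ℝ E) κ)
    (hA : MonotoneMap A) (hB : MonotoneOperator B) (ht : 0 < t) {x y x' u : E}
    (hy : IsForwardBackwardPoint A B t x y) (hxy : t * ‖A x - A y‖ ≤ θ * ‖x - y‖)
    (hx' : dualityMapping x' = dualityMapping y - t • (A y - A x)) (hu : u ∈ zeroSet A B) :
    lyapunov u x' ≤ lyapunov u x - (c - 2 * κ ^ 2 * θ ^ 2) * ‖x - y‖ ^ 2 := by
  obtain ⟨v, hv, e⟩ := hy
  obtain ⟨b, hb, hz⟩ := hu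
  have h1 := hκ.2 (dualityMapping y) (-(t • (A y - A x)))
  rw [dualityMapping_dualityMapping_apply hκ, ← sub_eq_add_neg, ← hx', norm_dualityMapping,
    norm_dualityMapping, norm_neg, norm_smul, Real.norm_of_nonneg ht.le, norm_sub_rev (A y)] at h1
  have h2 : (t * ‖A x - A y‖) ^ 2 ≤ (θ * ‖x - y‖) ^ 2 := pow_le_pow_left₀ (by positivity) hxy 2
  have h2' := mul_le_mul_of_nonneg_left h2 (show 0 ≤ 2 * κ ^ 2 by positivity)
  have h3 := h.le_lyapunov y x
  rw [norm_sub_rev] at h3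
  have h4 := mul_nonneg ht.le (hA y u)
  have h5 := mul_nonneg ht.le (hB _ _ _ hv _ hb)
  have h6 := DFunLike.congr_fun e y
  have h6' := DFunLike.congr_fun e u
  have h7 := DFunLike.congr_fun hz (y - u)
  have h8 := DFunLike.congr_fun hx' u
  have h9 := dualityMapping_apply_self y
  simp only [lyapunov, sub_apply, add_apply, smul_apply, smul_eq_mul, neg_apply, zero_apply,
    map_sub] at *
  have h7' : t * (A u y - A u u + (b y - b u)) = 0 := by
    have : A u y - A u u + (b y - b u) = 0 := by linarith
    rw [this, mul_zero]
  nlinarith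

theorem mem_zeroSet_of_weak_limit (hJ : DualityWeaklySequentiallyContinuous E)
    (hA : MonotoneMap A) (hL : LipschitzWith L A) (hB : MonotoneOperator B)
    {x y : ℕ → E} {t : ℕ → ℝ} {R τ : ℝ} (hτ : 0 < τ) (ht : ∀ n, τ ≤ t n) (hR : ∀ n, ‖x n‖ ≤ R)
    (hxy : Tendsto (fun n => ‖x n - y n‖) atTop (𝓝 0))
    (hfb : ∀ n, IsForwardBackwardPoint A B (t n) (x n) (y n)) {z : E}
    (hx : ∀ f : StrongDual ℝ E, Tendsto (fun n => f (x n)) atTop (𝓝 (f z)))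
    {w : E} {b : StrongDual ℝ E} (hb : b ∈ B w) : 0 ≤ (A w + b) (w - z) := by
  have hR0 : 0 ≤ R := (norm_nonneg _).trans (hR 0)
  have hy : ∀ f : StrongDual ℝ E, Tendsto (fun n => f (y n)) atTop (𝓝 (f z)) := by
    intro f
    have h1 : Tendsto (fun n => f (x n - y n)) atTop (𝓝 0) := by
      have := (f.continuous.tendsto 0).comp (tendsto_zero_iff_norm_tendsto_zero.2 hxy)
      rwa [map_zero] at this
    have := (hx f).sub h1
    rw [sub_zero] at this
    exact this.congr fun n => by rw [map_sub, sub_sub_cancel]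
  have hη : Tendsto (fun n => |dualityMapping (x n) w - dualityMapping (y n) w|) atTop (𝓝 0) := by
    have := ((hJ.tendsto_apply hx w).sub (hJ.tendsto_apply hy w)).abs
    rwa [sub_self, abs_zero] at this
  have hbound : ∀ n, (A w + b) (y n - w) ≤
      L * ‖x n - y n‖ * (R + ‖x n - y n‖ + ‖w‖) +
      (R * ‖x n - y n‖ + ‖x n - y n‖ * (2 * R + ‖x n - y n‖) +
        |dualityMapping (x n) w - dualityMapping (y n) w|) / τ := by
    intro n
    obtain ⟨v, hv, e⟩ := hfb n
    have htn := ht n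
    have htp : 0 < t n := hτ.trans_le htn
    have hyR : ‖y n‖ ≤ R + ‖x n - y n‖ := by
      have := norm_sub_norm_le (y n) (x n)
      rw [norm_sub_rev] at this
      linarith [hR n]
    have h1 := hA (y n) w
    have h2 := hB _ _ _ hv _ hb
    have h3 : (A (y n) - A (x n)) (y n - w) ≤ L * ‖x n - y n‖ * (R + ‖x n - y n‖ + ‖w‖) := by
      refine (hL.apply_sub_le _ _ _).trans ?_
      rw [norm_sub_rev (y n) (x n)]
      gcongr
      exact (norm_sub_le _ _).trans (by linarith)
    have h4 : t n * (A (x n) + v) (y n - w) =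
        (dualityMapping (x n) - dualityMapping (y n)) (y n - w) := by
      have := DFunLike.congr_fun e (y n - w)
      simp only [sub_apply, add_apply, smul_apply, smul_eq_mul] at this ⊢
      linarith
    -- No norm continuity of `J` is needed: the part along `y n` reduces to norms through `J x x =
    -- ‖x‖²`, and only the value at the fixed `w` uses weak continuity.
    have h5 : (dualityMapping (x n) - dualityMapping (y n)) (y n - w) ≤
        R * ‖x n - y n‖ + ‖x n - y n‖ * (2 * R + ‖x n - y n‖) +
        |dualityMapping (x n) w - dualityMapping (y n) w| := by
      have a1 := real_le_norm_apply (dualityMapping (x n)) (y n - x n)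
      rw [norm_dualityMapping, norm_sub_rev] at a1
      have a2 : ‖x n‖ * ‖x n - y n‖ ≤ R * ‖x n - y n‖ := by gcongr; exact hR n
      have a3 : ‖x n‖ ^ 2 - ‖y n‖ ^ 2 ≤ ‖x n - y n‖ * (2 * R + ‖x n - y n‖) := by
        have b1 := norm_sub_norm_le (x n) (y n)
        have b2 : ‖x n‖ + ‖y n‖ ≤ 2 * R + ‖x n - y n‖ := by linarith [hR n]
        calc ‖x n‖ ^ 2 - ‖y n‖ ^ 2 = (‖x n‖ - ‖y n‖) * (‖x n‖ + ‖y n‖) := by ring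
          _ ≤ ‖x n - y n‖ * (‖x n‖ + ‖y n‖) := by gcongr
          _ ≤ _ := by gcongr
      have a4 := neg_abs_le (dualityMapping (x n) w - dualityMapping (y n) w)
      simp only [sub_apply, map_sub, dualityMapping_apply_self] at a1 ⊢
      linarith
    have h6 : (A (x n) + v) (y n - w) ≤
        (R * ‖x n - y n‖ + ‖x n - y n‖ * (2 * R + ‖x n - y n‖) +
          |dualityMapping (x n) w - dualityMapping (y n) w|) / τ := by
      rw [← h4] at h5
      rw [le_div_iff₀ hτ]
      rcases le_total 0 ((A (x n) + v) (y n - w)) with hs | hs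
      · have := mul_le_mul_of_nonneg_right htn hs
        linarith
      · exact (mul_nonpos_of_nonpos_of_nonneg hs hτ.le).trans (by positivity)
    simp only [sub_apply, add_apply] at h1 h2 h3 h6 ⊢
    linarith
  have hlim : Tendsto (fun n => L * ‖x n - y n‖ * (R + ‖x n - y n‖ + ‖w‖) +
      (R * ‖x n - y n‖ + ‖x n - y n‖ * (2 * R + ‖x n - y n‖) +
        |dualityMapping (x n) w - dualityMapping (y n) w|) / τ) atTop
      (𝓝 (L * 0 * (R + 0 + ‖w‖) + (R * 0 + 0 * (2 * R + 0) + 0) / τ)) :=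
    ((hxy.const_mul _).mul ((hxy.const_add R).add_const _)).add
      ((((hxy.const_mul R).add (hxy.mul (hxy.const_add _))).add hη).div_const τ)
  have hlim' : Tendsto (fun n => (A w + b) (y n - w)) atTop (𝓝 ((A w + b) (z - w))) := by
    simp only [map_sub]
    exact (hy _).sub_const _
  have := le_of_tendsto_of_tendsto' hlim' hlim hbound
  rw [← neg_sub, map_neg]
  simp only [mul_zero, zero_mul, add_zero, zero_div] at this
  linarith

end ForwardBackwardForward

/-! ### Convergence of the algorithm. -/

theorem mainTheorem3 {E : Type*} [NormedAddCommGroup E] [NormedSpace ℝ E] [CompleteSpace E]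
    (hconv : TwoUniformlyConvex E) (hsmooth : UniformlySmooth E)
    (hJ : DualityWeaklySequentiallyContinuous E)
    (A : E → StrongDual ℝ E) (hA : MonotoneMap A) (L : ℝ≥0) (hL : LipschitzWith L A)
    (B : E → Set (StrongDual ℝ E)) (hB : MaximalMonotoneOperator B)
    (hne : (zeroSet A B).Nonempty)
    (μ : ℝ) (hμ : IsTwoUniformConvexityConstant E μ)
    (κ : ℝ) (hκ : IsTwoUniformSmoothnessConstant (StrongDual ℝ E) κ)
    (γ : ℝ) (hγ : 0 < γ) (l : ℝ) (hl : l ∈ Ioo (0 : ℝ) 1)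
    (θ : ℝ) (hθ : θ ∈ Ioo (0 : ℝ) (1 / (Real.sqrt (2 * μ) * κ)))
    (x y : ℕ → E) (stp : ℕ → ℝ) (hgen : GeneratedByLineSearch A B γ l θ x y stp) :
    ∃ z ∈ zeroSet A B,
      WeaklyConvergesTo x z ∧
      ∃ u : ℕ → E,
        (∀ n p, IsGeneralizedProjection (zeroSet A B) (x n) p ↔ p = u n) ∧
        Tendsto u atTop (𝓝 z) := by
  have hμ0 : 0 < μ := one_pos.trans_le hμ.1.1
  have hκ0 : 0 < κ := hκ.1
  have hc : 0 < μ⁻¹ := inv_pos.2 hμ0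
  have hq : QuadraticallyConvexNorm E μ⁻¹ := hμ.1.2
  have hsm : ∀ (x : E) (f : StrongDual ℝ E), f ∈ dualitySet x → f = dualityMapping x :=
    fun _ _ => hsmooth.eq_dualityMapping
  have hC : ∀ z, z ∈ zeroSet A B ↔ ∀ w, ∀ b ∈ B w, 0 ≤ (A w + b) (w - z) :=
    fun z => mem_zeroSet_iff_forall_nonneg hc hq hsm hA hL hB
  have hCclosed := isClosed_zeroSet hC
  have hCconv := convex_zeroSet hC
  have hφ0 : ∀ a b : E, 0 ≤ lyapunov a b := fun a b =>
    (mul_nonneg hc.le (sq_nonneg _)).trans (hq.le_lyapunov a b)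
  have hex : ∀ t > 0, ∀ x, ∃ y, IsForwardBackwardPoint A B t x y := fun t ht x =>
    hB.exists_eq_dualityMapping_add hc hq hsm ht _
  set τ : ℝ := min γ (l * θ / (L + 1)) with hτ
  have hτ0 : 0 < τ := by
    have := hl.1
    have := hθ.1
    exact lt_min hγ (by positivity)
  have hstp : ∀ n, τ ≤ stp n := fun n =>
    le_of_isGreatest_acceptedSteps hγ hl hL hex (hgen n).1
  have hstp0 : ∀ n, 0 < stp n := fun n => hτ0.trans_le (hstp n)
  have htest : ∀ n, stp n * ‖A (x n) - A (y n)‖ ≤ θ * ‖x n - y n‖ := by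
    intro n
    obtain ⟨-, y', hy', h⟩ := (hgen n).1.1
    rwa [hy'.unique hc hq hB.1 (hstp0 n) (hgen n).2.1] at h
  set e : ℝ := μ⁻¹ - 2 * κ ^ 2 * θ ^ 2 with he
  have he0 : 0 < e := by
    have h1 := hθ.2
    have h2 : 0 < √(2 * μ) * κ := by positivity
    rw [lt_div_iff₀ h2] at h1
    have h3 : (θ * (√(2 * μ) * κ)) ^ 2 < 1 := by
      have : 0 ≤ θ * (√(2 * μ) * κ) := mul_nonneg hθ.1.le h2.le
      exact pow_lt_one₀ this h1 two_ne_zero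
    have h4 : (θ * (√(2 * μ) * κ)) ^ 2 = μ * (2 * κ ^ 2 * θ ^ 2) := by
      rw [mul_pow, mul_pow, Real.sq_sqrt (by positivity)]
      ring
    rw [h4, ← lt_div_iff₀' hμ0, one_div] at h3
    exact sub_pos.2 h3
  have hdesc : ∀ u ∈ zeroSet A B, ∀ n,
      lyapunov u (x (n + 1)) ≤ lyapunov u (x n) - e * ‖x n - y n‖ ^ 2 := fun u hu n =>
    lyapunov_le_of_forward_backward_forward hq hκ hA hB.1 (hstp0 n) (hgen n).2.1 (htest n)
      (hgen n).2.2 hu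
  have hanti : ∀ u ∈ zeroSet A B, Antitone fun n => lyapunov u (x n) := fun u hu =>
    antitone_nat_of_succ_le fun n => (hdesc u hu n).trans
      (sub_le_self _ (mul_nonneg he0.le (sq_nonneg _)))
  have hlim : ∀ u ∈ zeroSet A B, ∃ a, Tendsto (fun n => lyapunov u (x n)) atTop (𝓝 a) :=
    fun u hu => ⟨_, tendsto_atTop_ciInf (hanti u hu) ⟨0, by rintro _ ⟨n, rfl⟩; exact hφ0 _ _⟩⟩
  obtain ⟨u₀, hu₀⟩ := hne
  have hxy : Tendsto (fun n => ‖x n - y n‖) atTop (𝓝 0) := by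
    obtain ⟨a, ha⟩ := hlim u₀ hu₀
    have h1 := (ha.sub ((tendsto_add_atTop_iff_nat 1).2 ha)).div_const e
    rw [sub_self, zero_div] at h1
    refine tendsto_zero_of_tendsto_sq (fun _ => norm_nonneg _)
      (squeeze_zero (fun _ => sq_nonneg _) (fun n => ?_) h1)
    rw [le_div_iff₀ he0]
    linarith [hdesc u₀ hu₀ n]
  obtain ⟨R, hR⟩ : ∃ R, ∀ n, ‖x n‖ ≤ R := by
    refine ⟨‖u₀‖ + √(lyapunov u₀ (x 0) / μ⁻¹), fun n => ?_⟩
    have h1 : ‖u₀ - x n‖ ≤ √(lyapunov u₀ (x 0) / μ⁻¹) := by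
      refine Real.le_sqrt_of_sq_le ?_
      rw [le_div_iff₀ hc, mul_comm]
      exact (hq.le_lyapunov _ _).trans (hanti u₀ hu₀ n.zero_le)
    have := norm_sub_norm_le (x n) u₀
    rw [norm_sub_rev] at this
    linarith
  have hsub : ∀ s : ℕ → ℕ, Tendsto s atTop atTop → ∃ z ∈ zeroSet A B, ∃ s' : ℕ → ℕ,
      Tendsto s' atTop atTop ∧
      ∀ f : StrongDual ℝ E, Tendsto (fun n => f (x (s (s' n)))) atTop (𝓝 (f z)) := by
    intro s hs
    obtain ⟨z, s', hs', hz⟩ := hq.exists_subseq_tendsto hc (fun n => x (s n)) (fun n => hR _)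
    refine ⟨z, (hC z).2 fun w b hb => ?_, s', hs'.tendsto_atTop, hz⟩
    exact mem_zeroSet_of_weak_limit hJ hA hL hB.1 hτ0 (fun n => hstp (s (s' n)))
      (fun n => hR (s (s' n))) (hxy.comp (hs.comp hs'.tendsto_atTop))
      (fun n => (hgen (s (s' n))).2.1) hz hb
  obtain ⟨z, hzC, s, hs, hz⟩ := hsub id tendsto_id
  -- Since `φ(z, xₙ) - φ(z', xₙ)` converges, so does `J xₙ (z' - z)`. Its limits along the two
  -- subsequences are `J z (z' - z)` and `J z' (z' - z)`; strong monotonicity of `J` concludes.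
  have huniq : ∀ z' ∈ zeroSet A B, ∀ s' : ℕ → ℕ, Tendsto s' atTop atTop →
      (∀ f : StrongDual ℝ E, Tendsto (fun n => f (x (s' n))) atTop (𝓝 (f z'))) → z' = z := by
    intro z' hz'C s' hs' hz'
    obtain ⟨a, ha⟩ := hlim z hzC
    obtain ⟨a', ha'⟩ := hlim z' hz'C
    have h1 : Tendsto (fun n => dualityMapping (x n) (z' - z)) atTop
        (𝓝 ((a - a' - (‖z‖ ^ 2 - ‖z'‖ ^ 2)) / 2)) := by
      refine (((ha.sub ha').sub_const _).div_const 2).congr fun n => ?_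
      simp only [lyapunov, map_sub]
      ring
    have h2 := tendsto_nhds_unique (h1.comp hs) (hJ.tendsto_apply hz (z' - z))
    have h3 := tendsto_nhds_unique (h1.comp hs') (hJ.tendsto_apply hz' (z' - z))
    have h4 := hq.le_dualityMapping_sub z' z
    rw [sub_apply, ← h2, ← h3, sub_self] at h4
    have h6 : ‖z' - z‖ ^ 2 = 0 :=
      le_antisymm (nonpos_of_mul_nonpos_right h4 hc) (sq_nonneg _)
    exact sub_eq_zero.1 (norm_eq_zero.1 (by simpa using h6))
  have hweak : ∀ f : StrongDual ℝ E, Tendsto (fun n => f (x n)) atTop (𝓝 (f z)) := by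
    intro f
    refine tendsto_of_subseq_tendsto fun ns hns => ?_
    obtain ⟨z', hz'C, s', hs', hz'⟩ := hsub ns hns
    rw [huniq z' hz'C (fun n => ns (s' n)) (hns.comp hs') hz'] at hz'
    exact ⟨s', hz' f⟩
  have hproj : ∀ n, ∃ p ∈ zeroSet A B, ∀ q ∈ zeroSet A B, lyapunov p (x n) ≤ lyapunov q (x n) :=
    fun n => exists_forall_le_of_midpoint (continuous_lyapunov (x n)) (fun _ => hφ0 _ _)
      (show 0 < μ⁻¹ / 4 by positivity) (hq.lyapunov_midpoint (x n)) ⟨u₀, hu₀⟩ hCclosed hCconv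
  choose u huC hu using hproj
  have hstrong : ∀ n, ∀ q ∈ zeroSet A B,
      2 * (μ⁻¹ / 4) * ‖u n - q‖ ^ 2 ≤ lyapunov q (x n) - lyapunov (u n) (x n) := fun n q hqC =>
    sq_norm_sub_le_of_midpoint (h := fun a => lyapunov a (x n)) (hq.lyapunov_midpoint (x n)) hCconv (huC n) hqC (hu n)
  have hcpos : 0 < 2 * (μ⁻¹ / 4) := by positivity
  -- For `n ≤ m`, `u n` competes with `u m` at `x m`, and `φ(u n, ·)` decreases along the iterates.
  have hcau : CauchySeq u := by
    refine cauchySeq_of_sq_norm_sub_le (r := fun n => lyapunov (u n) (x n)) hcpos ?_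
      (fun n => hφ0 _ _) fun n m hnm => ?_
    · exact fun n m hnm => (hu m _ (huC n)).trans (hanti _ (huC n) hnm)
    · exact (hstrong m _ (huC n)).trans (sub_le_sub_right (hanti _ (huC n) hnm) _)
  obtain ⟨p, hp⟩ := cauchySeq_tendsto_of_complete hcau
  have hpz : p = z := by
    have h1 : Tendsto (fun n => dualityMapping (x n) (u n)) atTop (𝓝 (dualityMapping z p)) :=
      tendsto_apply_of_norm_le (fun n => (norm_dualityMapping (x n)).trans_le (hR n)) hp
        (hJ.tendsto_apply hweak p)
    -- The limit of `φ(u n, x n) ≤ φ(z, x n)` after cancelling `‖x n‖²`; it says `φ(p, z) ≤ 0`.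
    have h2 : ‖p‖ ^ 2 - 2 * dualityMapping z p ≤ ‖z‖ ^ 2 - 2 * dualityMapping z z := by
      refine le_of_tendsto_of_tendsto' ((hp.norm.pow 2).sub (h1.const_mul 2))
        (((hJ.tendsto_apply hweak z).const_mul 2).const_sub _) fun n => ?_
      have := hu n z hzC
      simp only [lyapunov] at this
      linarith
    have h3 := hq.le_lyapunov p z
    rw [lyapunov] at h3
    rw [dualityMapping_apply_self] at h2
    have h6 : ‖p - z‖ ^ 2 = 0 :=
      le_antisymm (nonpos_of_mul_nonpos_right (h3.trans (by linarith)) hc) (sq_nonneg _)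
    exact sub_eq_zero.1 (norm_eq_zero.1 (by simpa using h6))
  refine ⟨z, hzC, weaklyConvergesTo_iff.2 hweak, u, fun n q => ⟨fun hqp => ?_, ?_⟩, hpz ▸ hp⟩
  · have h6 : ‖u n - q‖ ^ 2 = 0 := by
      refine le_antisymm (nonpos_of_mul_nonpos_right ((hstrong n q hqp.1).trans ?_) hcpos)
        (sq_nonneg _)
      linarith [hqp.2 _ (huC n)]
    exact (sub_eq_zero.1 (norm_eq_zero.1 (by simpa using h6))).symm
  · rintro rfl
    exact ⟨huC n, hu n⟩
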